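/- Let $\mathbb H=\mathbb R^3$ be the Heisenberg group with the group law $(x,y,t)\circ(x',y',t')=(x+x',\,y+y',\,t+t'+2(x'y-xy'))$, unit element $e=(0,0,0)$ and dilations $\delta_\tau(x,y,t)=(\tau x,\tau y,\tau^2t)$. Put $\|(x,y,t)\|_G=((x^2+y^2)^2+t^2)^{1/4}$ and let $B_G(\xi_0,r)=\{\xi_0\circ\xi:\ \|\xi\|_G\le r\}$ be the closed Korányi ball with centre $\xi_0$ and radius $r\ge 0$. A function $f:\mathbb H\to\mathbb R$ is *H-convex* if $$f\big(\xi\circ(\theta a,\theta b,0)\big)\le(1-\theta)f(\xi)+\theta f\big(\xi\circ(a,b,0)\big)\qquad\text{for all }\xi\in\mathbb H,\ (a,b)\in\mathbb R^2,\ \theta\in[0,1].$$ A compact set $K\subset\mathbb H$ *generates an H-convex family via dilations* if the sets $K_\tau=\delta_\tau K$, $\tau\in[0,+\infty)$, satisfy $\bigcup_{\tau\ge0}K_\tau=\mathbb H$, $K_{\tau_1}\subseteq K_{\tau_2}$ whenever $0\le\tau_1<\tau_2$, and $\bigcap_{\tau>\tau_0}K_\tau=K_{\tau_0}$ for every $\tau_0\ge0$,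 and there is an H-convex function $f:\mathbb H\to\mathbb R$ with $\{\xi\in\mathbb H:\ f(\xi)\le\tau\}=K_\tau$ for every $\tau\ge0$. A set $K\subset\mathbb H$ is *radial* if it is invariant under rotations about the $t$-axis, i.e. $(x_0,y_0,t_0)\in K$ if and only if $(x,y,t_0)\in K$ for all $(x,y)\in\mathbb R^2$ with $x^2+y^2=x_0^2+y_0^2$. **Theorem.** Let $K\subset\mathbb H$ be a radial and compact set which generates an H-convex family via dilations. Then: (i) if $\xi_0=(x_0,y_0,0)\in\partial K$, then $B_G(e,\|\xi_0\|_G)\subset K$; (ii) the projection of $K$ onto the $xy$-plane is contained in $K$, i.e. $(x,y,0)\in K$ for every $(x,y,t)\in K$. -/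

import Mathlib

/-- The underlying manifold `ℝ³` of the Heisenberg group; points are `(x, y, t)`. -/
abbrev Heis : Type := ℝ × ℝ × ℝ

namespace Heis

/-- The group law
`(x, y, t) ∘ (x', y', t') = (x + x', y + y', t + t' + 2 (x' y - x y'))`. -/
def op (ξ η : Heis) : Heis :=
  (ξ.1 + η.1, ξ.2.1 + η.2.1, ξ.2.2 + η.2.2 + 2 * (η.1 * ξ.2.1 - ξ.1 * η.2.1))

/-- The unit element `e = (0, 0, 0)`. -/
def e : Heis := (0, 0, 0)

/-- The anisotropic dilation `δ_τ (x, y, t) = (τ x, τ y, τ² t)`. -/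
def dil (τ : ℝ) (ξ : Heis) : Heis := (τ * ξ.1, τ * ξ.2.1, τ ^ 2 * ξ.2.2)

/-- The exponential of the horizontal vector `α X + β Y` of the first layer `V₁ ≃ ℝ²`. -/
def hexp (v : ℝ × ℝ) : Heis := (v.1, v.2, 0)

/-- The Korányi norm `‖(x, y, t)‖_G = ((x² + y²)² + t²)^{1/4}`. -/
noncomputable def gauge (ξ : Heis) : ℝ :=
  ((ξ.1 ^ 2 + ξ.2.1 ^ 2) ^ 2 + ξ.2.2 ^ 2) ^ (1 / 4 : ℝ)

/-- The closed Korányi ball with centre `ξ₀` and radius `r`: the left translate by `ξ₀` of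
`{ξ : ‖ξ‖_G ≤ r}`. -/
def gaugeBall (ξ₀ : Heis) (r : ℝ) : Set Heis := op ξ₀ '' {ξ | gauge ξ ≤ r}

/-- The projection onto the `xy`-plane. -/
def proj (ξ : Heis) : Heis := (ξ.1, ξ.2.1, 0)

/-- `K` is radial: `(x₀, y₀, t₀) ∈ K` if and only if `(x, y, t₀) ∈ K` for all `(x, y)` with the
same Euclidean norm as `(x₀, y₀)`. -/
def IsRadial (K : Set Heis) : Prop :=
  ∀ x₀ y₀ t₀ : ℝ, (x₀, y₀, t₀) ∈ K ↔
    ∀ x y : ℝ, √(x ^ 2 + y ^ 2) = √(x₀ ^ 2 + y₀ ^ 2) → (x, y, t₀) ∈ K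

/-- A function on the Heisenberg group is H-convex if it is convex along every horizontal
segment. -/
def HConvex (f : Heis → ℝ) : Prop :=
  ∀ (ξ : Heis) (v : ℝ × ℝ) (θ : ℝ), 0 ≤ θ → θ ≤ 1 →
    f (op ξ (hexp (θ • v))) ≤ (1 - θ) * f ξ + θ * f (op ξ (hexp v))

/-- The level set `lev_{≤ τ}(f)`. -/
def lev (f : Heis → ℝ) (τ : ℝ) : Set Heis := {ξ | f ξ ≤ τ}

/-- `{K τ}_{τ ∈ I}` is a family of level sets in the Heisenberg group, `I` being an interval. -/
structure IsLevelSetFamily (I : Set ℝ) (K : ℝ → Set Heis) : Prop where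
  interval : I.OrdConnected
  iUnion_eq : ⋃ τ ∈ I, K τ = Set.univ
  mono : ∀ τ₁ ∈ I, ∀ τ₂ ∈ I, τ₁ < τ₂ → K τ₁ ⊆ K τ₂
  iInter_eq : ∀ τ₀ ∈ I, ⋂ τ ∈ {τ | τ ∈ I ∧ τ₀ < τ}, K τ = K τ₀
  iInter_eq_empty : (¬ ∃ m, IsLeast I m) → ⋂ τ ∈ I, K τ = ∅

/-- A family of level sets is an H-convex family if its members are the level sets of some
H-convex function. -/
def IsHConvexFamily (I : Set ℝ) (K : ℝ → Set Heis) : Prop :=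
  IsLevelSetFamily I K ∧ ∃ f : Heis → ℝ, HConvex f ∧ ∀ τ ∈ I, lev f τ = K τ

/-- `K` generates an H-convex family via dilations: `{δ_τ K}_{τ ∈ [0, ∞)}` is an H-convex
family. -/
def GeneratesHConvexFamily (K : Set Heis) : Prop :=
  IsHConvexFamily (Set.Ici 0) (fun τ => dil τ '' K)

end Heis

/-! The function `f` whose sublevel sets are the dilates of `K` is a radial, positively homogeneous
H-convex gauge and `K = {f ≤ 1}`. With `c = f (1, 0, 0)`, (i) reduces to `f ≤ c * gauge`
(`le_gauge`) and (ii) to `f (proj ξ) ≤ f ξ` (`proj_le`).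

For the first, fix `t > 0` and let `q` be the squared radius. H-convexity along a horizontal line
tangent to a dilation orbit bounds the logarithmic derivative of `f` in `q` below by that of `gauge`
(`log_add_le`), so `f / gauge` increases with `q` (`div_mono`). By homogeneity its behaviour as `q →
∞` is governed by `f` near `(1, 0, 0)`, where `apply_one_le` bounds the limit by `c`.

For the second, `f (r, 0, t)` is convex in `r`, and the first bound limits its slope to `c`. A
midpoint inequality centred on the plane, combined with the same bound at height `-t`, shows that `f
(R, 0, t) ≥ c * R - o(1)` for large `R`. Going back from `R` to `r` loses at most `c * (R - r)`,
which leaves `c * r = f (r, 0, 0)`. -/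

open Filter Topology

namespace Heis

/-- A nonnegative H-convex function that vanishes only at the origin, is invariant under rotations
about the `t`-axis and is positively homogeneous of degree one for the dilations. -/
structure IsRadialHConvexGauge (f : Heis → ℝ) : Prop where
  hconvex : HConvex f
  radial : ∀ x y x' y' t : ℝ, x ^ 2 + y ^ 2 = x' ^ 2 + y' ^ 2 → f (x, y, t) = f (x', y', t)
  homog : ∀ (a : ℝ) (ξ : Heis), 0 < a → f (dil a ξ) = a * f ξ
  pos : ∀ ξ : Heis, ξ ≠ e → 0 < f ξ

/-- The group automorphism `(x, y, t) ↦ (x, -y, -t)`. -/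
def reflect (ξ : Heis) : Heis := (ξ.1, -ξ.2.1, -ξ.2.2)

/-! ### Horizontal convexity and elementary properties of radial gauges -/

theorem HConvex.le_combination {f : Heis → ℝ} (hf : HConvex f) (x y t a b θ : ℝ) (h0 : 0 ≤ θ)
    (h1 : θ ≤ 1) :
    f (x, y, t) ≤ (1 - θ) * f (x - θ * a, y - θ * b, t - 2 * θ * (a * y - x * b)) +
      θ * f (x + (1 - θ) * a, y + (1 - θ) * b, t + 2 * (1 - θ) * (a * y - x * b)) := by
  have h := hf (x - θ * a, y - θ * b, t - 2 * θ * (a * y - x * b)) (a, b) θ h0 h1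
  simp only [op, hexp, Prod.smul_mk, smul_eq_mul] at h
  have e1 : (x - θ * a + θ * a, y - θ * b + θ * b, t - 2 * θ * (a * y - x * b) + 0 +
      2 * (θ * a * (y - θ * b) - (x - θ * a) * (θ * b))) = (x, y, t) := by
    simp only [Prod.mk.injEq]
    refine ⟨by ring, by ring, by ring⟩
  have e2 : (x - θ * a + a, y - θ * b + b, t - 2 * θ * (a * y - x * b) + 0 +
      2 * (a * (y - θ * b) - (x - θ * a) * b)) =
      (x + (1 - θ) * a, y + (1 - θ) * b, t + 2 * (1 - θ) * (a * y - x * b)) := by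
    simp only [Prod.mk.injEq]
    refine ⟨by ring, by ring, by ring⟩
  rwa [e1, e2] at h

theorem HConvex.le_midpoint {f : Heis → ℝ} (hf : HConvex f) (x y t a b : ℝ) :
    f (x, y, t) ≤ (f (x - a, y - b, t - 2 * (a * y - x * b)) +
      f (x + a, y + b, t + 2 * (a * y - x * b))) / 2 := by
  have h := hf.le_combination x y t (2 * a) (2 * b) (1 / 2) (by norm_num) (by norm_num)
  ring_nf at h ⊢
  linarith

namespace IsRadialHConvexGauge

variable {f : Heis → ℝ}

/-- Transfers results from positive to negative heights. -/
theorem comp_reflect (hf : IsRadialHConvexGauge f) : IsRadialHConvexGauge (f ∘ reflect) where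
  hconvex ξ v θ h0 h1 := by
    have h := hf.hconvex (reflect ξ) (v.1, -v.2) θ h0 h1
    have key : ∀ w : ℝ × ℝ, reflect (op ξ (hexp w)) = op (reflect ξ) (hexp (w.1, -w.2)) := by
      intro w
      simp only [reflect, op, hexp, Prod.mk.injEq]
      refine ⟨trivial, by ring, by ring⟩
    simp only [Function.comp, key]
    simpa using h
  radial x y x' y' t h := hf.radial _ _ _ _ _ (by simpa using h)
  homog a ξ ha := by
    rw [Function.comp_apply, Function.comp_apply, ← hf.homog a _ ha]
    simp [reflect, dil]
  pos ξ hξ := hf.pos _ fun h => hξ <| by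
    obtain ⟨x, y, t⟩ := ξ
    simpa [reflect, e] using h

theorem apply_unit (hf : IsRadialHConvexGauge f) : f e = 0 := by
  have h := hf.homog 2 e two_pos
  rw [show dil 2 e = e by simp [dil, e]] at h
  linarith

theorem nonneg (hf : IsRadialHConvexGauge f) (ξ : Heis) : 0 ≤ f ξ := by
  rcases eq_or_ne ξ e with rfl | h
  · exact hf.apply_unit.ge
  · exact (hf.pos ξ h).le

theorem apply_smul (hf : IsRadialHConvexGauge f) {a : ℝ} (ha : 0 < a) (r t : ℝ) :
    f (a * r, 0, a ^ 2 * t) = a * f (r, 0, t) := by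
  rw [← hf.homog a _ ha]
  simp [dil]

theorem apply_planar (hf : IsRadialHConvexGauge f) {r : ℝ} (hr : 0 ≤ r) :
    f (r, 0, 0) = r * f (1, 0, 0) := by
  rcases hr.eq_or_lt with rfl | hr
  · simpa [e] using hf.apply_unit
  · simpa using hf.apply_smul hr 1 0

theorem apply_eq_sqrt (hf : IsRadialHConvexGauge f) (x y t : ℝ) :
    f (x, y, t) = f (√(x ^ 2 + y ^ 2), 0, t) :=
  hf.radial _ _ _ _ _ (by rw [Real.sq_sqrt (by positivity)]; ring)

theorem convexOn (hf : IsRadialHConvexGauge f) (t : ℝ) :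
    ConvexOn ℝ Set.univ fun r => f (r, 0, t) := by
  refine ⟨convex_univ, fun r _ r' _ a b ha hb hab => ?_⟩
  have h := hf.hconvex (r, 0, t) (r' - r, 0) b hb (by linarith)
  obtain rfl : a = 1 - b := by linarith
  simp only [op, hexp, Prod.smul_mk, smul_eq_mul] at h ⊢
  ring_nf at h ⊢
  linarith

/-- An even convex function of `r` is nondecreasing on `r ≥ 0`. -/
theorem mono_radius (hf : IsRadialHConvexGauge f) (t : ℝ) {r r' : ℝ} (hr : 0 ≤ r) (hrr : r ≤ r') :
    f (r, 0, t) ≤ f (r', 0, t) := by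
  have h := (hf.convexOn t).le_max_of_mem_Icc (x := -r') (y := r') (z := r) trivial trivial
    ⟨by linarith, hrr⟩
  have h' : f (-r', 0, t) = f (r', 0, t) := hf.radial _ _ _ _ _ (by ring)
  simpa [h'] using h

/-! ### Upper bound by the Korányi norm -/

/-- Near the plane `t = 0` the function is bounded above by its values on the plane. -/
theorem apply_one_le (hf : IsRadialHConvexGauge f) {τ : ℝ} (h0 : 0 < τ) (h1 : τ ≤ 1) :
    f (1, 0, τ) ≤ √(1 + τ ^ 2 / 4) * f (1, 0, 0) + τ * (2 * f (1, 0, 1)) := by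
  have hl0 : 0 ≤ τ / 2 / (1 + τ / 2) := by positivity
  have hl1 : τ / 2 / (1 + τ / 2) ≤ τ / 2 := div_le_self (by positivity) (by linarith)
  -- The horizontal segment runs from `(1, τ/2, 0)`, in the plane, to `(1, -1, τ + 2)`; the far end
  -- has weight at most `τ / 2`.
  have h := hf.hconvex.le_combination 1 0 τ 0 (-(1 + τ / 2)) (τ / 2 / (1 + τ / 2)) hl0
    (by linarith)
  have e1 : τ / 2 / (1 + τ / 2) * (1 + τ / 2) = τ / 2 := by field_simp
  set l := τ / 2 / (1 + τ / 2)
  have p1 : f (1 - l * 0, 0 - l * -(1 + τ / 2), τ - 2 * l * (0 * 0 - 1 * -(1 + τ / 2))) =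
      √(1 + τ ^ 2 / 4) * f (1, 0, 0) := by
    rw [← hf.apply_planar (Real.sqrt_nonneg _),
      show τ - 2 * l * (0 * 0 - 1 * -(1 + τ / 2)) = 0 by linear_combination -2 * e1]
    refine hf.radial _ _ _ _ _ ?_
    rw [Real.sq_sqrt (by positivity), show 0 - l * -(1 + τ / 2) = τ / 2 by linear_combination e1]
    ring
  have p2 : f (1 + (1 - l) * 0, 0 + (1 - l) * -(1 + τ / 2),
      τ + 2 * (1 - l) * (0 * 0 - 1 * -(1 + τ / 2))) ≤ 2 * f (1, 0, 1) := by
    have hs : 0 < √(τ + 2) := Real.sqrt_pos.2 (by linarith)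
    have hs2 : √(τ + 2) ^ 2 = τ + 2 := Real.sq_sqrt (by linarith)
    have hsle : √(τ + 2) ≤ 2 := Real.sqrt_le_iff.2 ⟨by norm_num, by linarith⟩
    rw [show τ + 2 * (1 - l) * (0 * 0 - 1 * -(1 + τ / 2)) = τ + 2 by linear_combination -2 * e1,
      hf.radial _ _ (√2) 0 (τ + 2)
        (by rw [show 0 + (1 - l) * -(1 + τ / 2) = -1 by linear_combination e1,
          Real.sq_sqrt zero_le_two]; norm_num)]
    calc f (√2, 0, τ + 2) ≤ f (√(τ + 2) * 1, 0, √(τ + 2) ^ 2 * 1) := by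
          rw [hs2, mul_one, mul_one]
          exact hf.mono_radius _ (Real.sqrt_nonneg _) (Real.sqrt_le_sqrt (by linarith))
      _ = √(τ + 2) * f (1, 0, 1) := hf.apply_smul hs _ _
      _ ≤ 2 * f (1, 0, 1) := mul_le_mul_of_nonneg_right hsle (hf.nonneg _)
  rw [p1] at h
  have hA : 0 ≤ √(1 + τ ^ 2 / 4) * f (1, 0, 0) := mul_nonneg (Real.sqrt_nonneg _) (hf.nonneg _)
  have hB : 0 ≤ 2 * f (1, 0, 1) := mul_nonneg two_pos.le (hf.nonneg _)
  have h3 := mul_le_mul_of_nonneg_left p2 hl0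
  nlinarith [mul_nonneg hl0 hA, mul_le_mul_of_nonneg_right (hl1.trans (half_le_self h0.le)) hB]

/-- The growth of the function in the squared radius, obtained from the horizontal line that is
tangent to the parabola through the given point that dilations generate. -/
theorem log_add_le (hf : IsRadialHConvexGauge f) {q t s : ℝ} (hq : 0 < q) (ht : 0 < t)
    (hs : 0 < s) (hs2 : s < 1 / 2) :
    Real.log (f (√q, 0, t)) + s ^ 2 / 2 ≤
      Real.log (f (√(q + s ^ 2 * (q + t ^ 2 / q) / (1 - 2 * s)), 0, t)) := by
  have hr : 0 < √q := Real.sqrt_pos.2 hq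
  have hrq : √q ^ 2 = q := Real.sq_sqrt hq.le
  set D := q + t ^ 2 / q
  have hD : 0 < D := by positivity
  -- Dilating a point of the line back to height `t` changes the squared radius only at order `s ^
  -- 2`: this is the tangency.
  have key : ∀ s : ℝ, 0 < 1 + 2 * s →
      f (√q + s * √q, 0 + s * (-(t / √q)), t + s * (2 * t)) =
        √(1 + 2 * s) * f (√(q + s ^ 2 * D / (1 + 2 * s)), 0, t) := by
    intro s hs
    rw [← hf.apply_smul (Real.sqrt_pos.2 hs), Real.sq_sqrt hs.le,
      show t + s * (2 * t) = (1 + 2 * s) * t by ring]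
    refine hf.radial _ _ _ _ _ ?_
    rw [mul_pow, Real.sq_sqrt hs.le, Real.sq_sqrt (by positivity)]
    have : (s * -(t / √q)) ^ 2 = s ^ 2 * (t ^ 2 / q) := by rw [mul_pow, neg_sq, div_pow, hrq]
    rw [zero_add, this, show (√q + s * √q) ^ 2 = (1 + s) ^ 2 * √q ^ 2 by ring, hrq]
    simp only [D]
    have h1 : (1 + 2 * s) * (s ^ 2 * (q + t ^ 2 / q) / (1 + 2 * s)) = s ^ 2 * (q + t ^ 2 / q) :=
      mul_div_cancel₀ _ hs.ne'
    linear_combination -h1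
  have hm := hf.hconvex.le_midpoint (√q) 0 t (s * √q) (s * (-(t / √q)))
  have e1 : 2 * (s * √q * 0 - √q * (s * (-(t / √q)))) = s * (2 * t) := by field_simp; ring
  rw [e1, key s (by linarith)] at hm
  have k2 := key (-s) (by linarith)
  rw [show √q + -s * √q = √q - s * √q by ring,
    show 0 + -s * -(t / √q) = 0 - s * -(t / √q) by ring,
    show t + -s * (2 * t) = t - s * (2 * t) by ring,
    show 1 + 2 * -s = 1 - 2 * s by ring, neg_sq] at k2
  rw [k2] at hm
  have hmono : f (√(q + s ^ 2 * D / (1 + 2 * s)), 0, t) ≤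
      f (√(q + s ^ 2 * D / (1 - 2 * s)), 0, t) := by
    refine hf.mono_radius _ (Real.sqrt_nonneg _) (Real.sqrt_le_sqrt ?_)
    have : s ^ 2 * D / (1 + 2 * s) ≤ s ^ 2 * D / (1 - 2 * s) :=
      div_le_div_of_nonneg_left (by positivity) (by linarith) (by linarith)
    linarith
  -- The cubic terms of this bound and the next cancel, so the two roots sum to at most `2 - s ^ 2`.
  have s1 : √(1 + 2 * s) ≤ 1 + s - s ^ 2 / 2 + s ^ 3 / 2 := by
    refine Real.sqrt_le_iff.2 ⟨by nlinarith [pow_pos hs 3], ?_⟩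
    have : 0 ≤ s ^ 4 * (5 - 2 * s + s ^ 2) := by
      have : 0 ≤ 5 - 2 * s + s ^ 2 := by nlinarith
      positivity
    nlinarith
  have s2 : √(1 - 2 * s) ≤ 1 - s - s ^ 2 / 2 - s ^ 3 / 2 := by
    refine Real.sqrt_le_iff.2 ⟨by nlinarith [pow_pos hs 3, mul_pos hs hs], ?_⟩
    have : 0 ≤ s ^ 4 * (5 + 2 * s + s ^ 2) := by positivity
    nlinarith
  have hp0 : 0 < f (√q, 0, t) := hf.pos _ (by simp [e, ht.ne'])
  set G := f (√(q + s ^ 2 * D / (1 - 2 * s)), 0, t)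
  have hp1 : 0 < G := hf.pos _ (by simp [e, ht.ne'])
  have hle : f (√q, 0, t) ≤ (1 - s ^ 2 / 2) * G := by
    have := mul_le_mul_of_nonneg_left hmono (Real.sqrt_nonneg (1 + 2 * s))
    have := mul_le_mul_of_nonneg_right (add_le_add s1 s2) hp1.le
    nlinarith
  have hle' : f (√q, 0, t) ≤ Real.exp (-(s ^ 2 / 2)) * G := by
    refine hle.trans (mul_le_mul_of_nonneg_right ?_ hp1.le)
    linarith [Real.add_one_le_exp (-(s ^ 2 / 2))]
  have := Real.log_le_log hp0 hle'
  rw [Real.log_mul (Real.exp_pos _).ne' hp1.ne', Real.log_exp] at this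
  linarith

/-- Letting `s → 0` in `log_add_le` gives a right slope of at least `1 / (2 * D)`, with `D = q + t ^
2 / q`, which is exactly the derivative of `log (q ^ 2 + t ^ 2) / 4`. Only slopes of `f` are
available, so a comparison principle for continuous functions, applied to the negated logarithm,
replaces differentiation. -/
theorem log_sub_mono (hf : IsRadialHConvexGauge f) {a b t : ℝ} (ha : 0 < a) (hab : a ≤ b)
    (ht : 0 < t) :
    Real.log (f (√a, 0, t)) - Real.log (a ^ 2 + t ^ 2) / 4 ≤
      Real.log (f (√b, 0, t)) - Real.log (b ^ 2 + t ^ 2) / 4 := by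
  have hcont : Continuous fun r => f (r, 0, t) :=
    continuousOn_univ.1 ((hf.convexOn t).continuousOn isOpen_univ)
  have hG : Continuous fun q => -Real.log (f (√q, 0, t)) :=
    ((hcont.comp Real.continuous_sqrt).log fun q => (hf.pos _ (by simp [e, ht.ne'])).ne').neg
  let B : ℝ → ℝ := fun q => Real.log (a ^ 2 + t ^ 2) / 4 - Real.log (f (√a, 0, t)) -
    Real.log (q ^ 2 + t ^ 2) / 4
  have hB : ∀ q, HasDerivAt B (-(2 * q / (q ^ 2 + t ^ 2) / 4)) q := by
    intro q
    have h1 : HasDerivAt (fun q : ℝ => q ^ 2 + t ^ 2) (2 * q) q := by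
      simpa using (hasDerivAt_pow 2 q).add_const (t ^ 2)
    simpa using ((h1.log (by positivity)).div_const 4).const_sub
      (Real.log (a ^ 2 + t ^ 2) / 4 - Real.log (f (√a, 0, t)))
  have main := image_le_of_liminf_slope_right_le_deriv_boundary (a := a) (b := b)
    (f := fun q => -Real.log (f (√q, 0, t))) (B := B) hG.continuousOn (by simp [B])
    (fun q _ => (hB q).continuousAt.continuousWithinAt)
    (fun q _ => (hB q).hasDerivWithinAt) ?_ (Set.right_mem_Icc.2 hab)
  · simp only [B] at main
    linarith
  intro q hq r hr
  have hq0 : 0 < q := ha.trans_le hq.1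
  set D := q + t ^ 2 / q with hDdef
  have hD : 0 < D := by positivity
  have hDe : 2 * q / (q ^ 2 + t ^ 2) / 4 = 1 / (2 * D) := by
    rw [hDdef]
    field_simp
    ring
  rw [hDe] at hr
  have hlt : ∀ᶠ s : ℝ in 𝓝[>] 0, 0 < s ∧ s < 1 / 2 ∧ -((1 - 2 * s) / (2 * D)) < r := by
    refine (eventually_mem_nhdsWithin).and ?_
    refine eventually_nhdsWithin_of_eventually_nhds ?_
    refine (eventually_lt_nhds (by norm_num)).and ?_
    have : ContinuousAt (fun s : ℝ => -((1 - 2 * s) / (2 * D))) 0 := by fun_prop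
    exact this.eventually_lt continuousAt_const (by simpa using hr)
  have htend : Tendsto (fun s : ℝ => q + s ^ 2 * D / (1 - 2 * s)) (𝓝[>] 0) (𝓝[>] q) := by
    refine tendsto_nhdsWithin_iff.2 ⟨?_, hlt.mono fun s hs => ?_⟩
    · have : ContinuousAt (fun s : ℝ => q + s ^ 2 * D / (1 - 2 * s)) 0 := by
        refine ContinuousAt.add continuousAt_const (ContinuousAt.div ?_ ?_ (by norm_num)) <;>
          fun_prop
      simpa using this.tendsto.mono_left nhdsWithin_le_nhds
    · have : 0 < 1 - 2 * s := by linarith [hs.2.1]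
      have := hs.1
      simp only [Set.mem_Ioi, lt_add_iff_pos_right]
      positivity
  refine htend.frequently (hlt.mono fun s hs => ?_).frequently
  obtain ⟨h0, h1, h2⟩ := hs
  refine lt_of_le_of_lt ?_ h2
  have h12 : 0 < 1 - 2 * s := by linarith
  have hlog := hf.log_add_le hq0 ht h0 h1
  rw [← hDdef] at hlog
  rw [slope_def_field, add_sub_cancel_left, div_le_iff₀ (by positivity)]
  have : -((1 - 2 * s) / (2 * D)) * (s ^ 2 * D / (1 - 2 * s)) = -(s ^ 2 / 2) := by field_simp
  rw [this]
  linarith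

theorem div_mono (hf : IsRadialHConvexGauge f) {a b t : ℝ} (ha : 0 < a) (hab : a ≤ b)
    (ht : 0 < t) :
    f (√a, 0, t) / (a ^ 2 + t ^ 2) ^ (1 / 4 : ℝ) ≤
      f (√b, 0, t) / (b ^ 2 + t ^ 2) ^ (1 / 4 : ℝ) := by
  have hp : ∀ q : ℝ, 0 < f (√q, 0, t) := fun q => hf.pos _ (by simp [e, ht.ne'])
  have hw : ∀ q : ℝ, 0 < q ^ 2 + t ^ 2 := fun q => by positivity
  have hw' : ∀ q : ℝ, 0 < (q ^ 2 + t ^ 2) ^ (1 / 4 : ℝ) := fun q => Real.rpow_pos_of_pos (hw q) _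
  refine (Real.log_le_log_iff (div_pos (hp a) (hw' a)) (div_pos (hp b) (hw' b))).1 ?_
  rw [Real.log_div (hp a).ne' (hw' a).ne', Real.log_div (hp b).ne' (hw' b).ne',
    Real.log_rpow (hw a), Real.log_rpow (hw b)]
  linarith [hf.log_sub_mono ha hab ht]

theorem apply_le_of_pos_radius (hf : IsRadialHConvexGauge f) {q t : ℝ} (hq : 0 < q) (ht : 0 < t) :
    f (√q, 0, t) ≤ f (1, 0, 0) * (q ^ 2 + t ^ 2) ^ (1 / 4 : ℝ) := by
  rw [← div_le_iff₀ (Real.rpow_pos_of_pos (by positivity) _)]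
  have hlim : Tendsto (fun b : ℝ => √(1 + (t / b) ^ 2 / 4) * f (1, 0, 0) +
      t / b * (2 * f (1, 0, 1))) atTop (𝓝 (f (1, 0, 0))) := by
    have h0 : Tendsto (fun b : ℝ => t / b) atTop (𝓝 0) := tendsto_const_nhds.div_atTop tendsto_id
    have hc : Continuous fun τ : ℝ => √(1 + τ ^ 2 / 4) * f (1, 0, 0) + τ * (2 * f (1, 0, 1)) := by
      fun_prop
    have h1 := (hc.tendsto 0).comp h0
    simp only [Function.comp_def] at h1
    simpa using h1
  refine ge_of_tendsto hlim ?_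
  filter_upwards [eventually_ge_atTop q, eventually_ge_atTop t] with b hbq hbt
  have hb : 0 < b := hq.trans_le hbq
  -- Dilation by `√b` turns the ratio at a large squared radius `b` into a value near `(1, 0, 0)`.
  refine (hf.div_mono hq hbq ht).trans ((?_ : _ ≤ f (1, 0, t / b)).trans
    (hf.apply_one_le (by positivity) ((div_le_one hb).2 hbt)))
  have hs : 0 < √b := Real.sqrt_pos.2 hb
  have he : f (√b, 0, t) = √b * f (1, 0, t / b) := by
    rw [← hf.apply_smul hs, Real.sq_sqrt hb.le, mul_one, mul_div_cancel₀ _ hb.ne']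
  have hle : √b ≤ (b ^ 2 + t ^ 2) ^ (1 / 4 : ℝ) := by
    calc √b = (b ^ 2) ^ (1 / 4 : ℝ) := by
          rw [Real.sqrt_eq_rpow, ← Real.rpow_natCast, ← Real.rpow_mul hb.le]; norm_num
      _ ≤ _ := Real.rpow_le_rpow (by positivity) (by nlinarith) (by norm_num)
  rw [he, div_le_iff₀ (hs.trans_le hle), mul_comm]
  exact mul_le_mul_of_nonneg_left hle (hf.nonneg _)

/-- The axis `r = 0` is reached as a limit of positive radii, by monotonicity in the radius. -/
theorem apply_le_of_pos_height (hf : IsRadialHConvexGauge f) {r t : ℝ} (hr : 0 ≤ r) (ht : 0 < t) :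
    f (r, 0, t) ≤ f (1, 0, 0) * ((r ^ 2) ^ 2 + t ^ 2) ^ (1 / 4 : ℝ) := by
  have hlim : Tendsto (fun q : ℝ => f (1, 0, 0) * (q ^ 2 + t ^ 2) ^ (1 / 4 : ℝ)) (𝓝[>] (r ^ 2))
      (𝓝 (f (1, 0, 0) * ((r ^ 2) ^ 2 + t ^ 2) ^ (1 / 4 : ℝ))) := by
    have hc : Continuous fun q : ℝ => f (1, 0, 0) * (q ^ 2 + t ^ 2) ^ (1 / 4 : ℝ) :=
      continuous_const.mul (Continuous.rpow_const (by fun_prop) fun _ => Or.inr (by norm_num))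
    exact (hc.tendsto _).mono_left nhdsWithin_le_nhds
  refine ge_of_tendsto hlim ?_
  filter_upwards [self_mem_nhdsWithin] with q hq
  have hq : r ^ 2 < q := hq
  have hq0 : 0 < q := (sq_nonneg r).trans_lt hq
  exact (hf.mono_radius t hr (Real.le_sqrt_of_sq_le hq.le)).trans
    (hf.apply_le_of_pos_radius hq0 ht)

theorem apply_le (hf : IsRadialHConvexGauge f) {r : ℝ} (hr : 0 ≤ r) (t : ℝ) :
    f (r, 0, t) ≤ f (1, 0, 0) * ((r ^ 2) ^ 2 + t ^ 2) ^ (1 / 4 : ℝ) := by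
  rcases lt_trichotomy t 0 with ht | rfl | ht
  · have h := hf.comp_reflect.apply_le_of_pos_height hr (neg_pos.2 ht)
    simpa [reflect] using h
  · rw [hf.apply_planar hr, mul_comm]
    refine le_of_eq ?_
    congr 1
    rw [← pow_mul, zero_pow two_ne_zero, add_zero, ← Real.rpow_natCast, ← Real.rpow_mul hr]
    norm_num
  · exact hf.apply_le_of_pos_height hr ht

theorem le_gauge (hf : IsRadialHConvexGauge f) (ξ : Heis) : f ξ ≤ f (1, 0, 0) * gauge ξ := by
  obtain ⟨x, y, t⟩ := ξ
  have h := hf.apply_le (Real.sqrt_nonneg (x ^ 2 + y ^ 2)) t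
  rwa [Real.sq_sqrt (by positivity), ← hf.apply_eq_sqrt] at h

/-! ### Lower bound by the value on the plane -/

theorem _root_.Real.rpow_one_div_four_le {R t : ℝ} (hR : 0 < R) :
    ((R ^ 2) ^ 2 + t ^ 2) ^ (1 / 4 : ℝ) ≤ R + t ^ 2 / (4 * R ^ 3) := by
  have h0 : 0 ≤ t ^ 2 / (4 * R ^ 3) := by positivity
  have h4 : (R ^ 2) ^ 2 + t ^ 2 ≤ (R + t ^ 2 / (4 * R ^ 3)) ^ 4 := by
    have e1 : t ^ 2 = 4 * R ^ 3 * (t ^ 2 / (4 * R ^ 3)) := by field_simp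
    set a := t ^ 2 / (4 * R ^ 3)
    rw [e1]
    have : 0 ≤ 6 * R ^ 2 * a ^ 2 + 4 * R * a ^ 3 + a ^ 4 := by positivity
    nlinarith
  calc _ ≤ ((R + t ^ 2 / (4 * R ^ 3)) ^ 4) ^ (1 / 4 : ℝ) :=
        Real.rpow_le_rpow (by positivity) h4 (by norm_num)
    _ = _ := by
        rw [← Real.rpow_natCast, ← Real.rpow_mul (by positivity)]
        norm_num

/-- Secant slopes of a convex function increase, and the upper bound makes those from `r` to `R` at
most `f (1, 0, 0)` in the limit `R → ∞`. -/
theorem apply_le_add_mul (hf : IsRadialHConvexGauge f) {r r' : ℝ} (hr : 0 ≤ r) (hrr : r < r') (t : ℝ) :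
    f (r', 0, t) ≤ f (r, 0, t) + (r' - r) * f (1, 0, 0) := by
  have hlim : Tendsto (fun R : ℝ => f (r, 0, t) + (r' - r) *
      ((f (1, 0, 0) * (r + t ^ 2) - f (r, 0, t)) / (R - r) + f (1, 0, 0))) atTop
      (𝓝 (f (r, 0, t) + (r' - r) * (0 + f (1, 0, 0)))) := by
    refine tendsto_const_nhds.add (tendsto_const_nhds.mul (Tendsto.add ?_ tendsto_const_nhds))
    exact tendsto_const_nhds.div_atTop (tendsto_atTop_add_const_right _ _ tendsto_id)
  rw [zero_add] at hlim
  refine ge_of_tendsto hlim ?_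
  filter_upwards [eventually_gt_atTop r', eventually_ge_atTop 1] with R hR hR1
  have hc := hf.nonneg (1, 0, 0)
  have hs := (hf.convexOn t).secant_mono (a := r) (x := r') (y := R) trivial trivial trivial
    hrr.ne' (hrr.trans hR).ne' hR.le
  have hR' : f (R, 0, t) ≤ f (1, 0, 0) * (R + t ^ 2) := by
    refine (hf.apply_le (by linarith) t).trans (mul_le_mul_of_nonneg_left ?_ hc)
    refine (Real.rpow_one_div_four_le (by linarith)).trans ?_
    have : t ^ 2 / (4 * R ^ 3) ≤ t ^ 2 :=
      div_le_self (sq_nonneg t) (by nlinarith [one_le_pow₀ hR1 (n := 3)])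
    linarith
  have h0 : 0 < R - r := by linarith
  have h1 : (f (R, 0, t) - f (r, 0, t)) / (R - r) ≤
      (f (1, 0, 0) * (r + t ^ 2) - f (r, 0, t)) / (R - r) + f (1, 0, 0) := by
    rw [div_add' _ _ _ h0.ne']
    exact div_le_div_of_nonneg_right (by linarith) h0.le
  have h2 := (div_le_iff₀ (by linarith : 0 < r' - r)).1 (hs.trans h1)
  linarith

theorem mul_sub_le_apply (hf : IsRadialHConvexGauge f) {ρ : ℝ} (hρ : 0 < ρ) (t : ℝ) :
    f (1, 0, 0) * (√(ρ ^ 2 + (t / (2 * ρ)) ^ 2) - t ^ 2 / (2 * ρ ^ 3)) ≤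
      f (√(ρ ^ 2 + (t / (2 * ρ)) ^ 2), 0, t) := by
  set s := t / (2 * ρ) with hs
  have hc := hf.nonneg (1, 0, 0)
  have hts : 2 * (ρ * s) = t := by rw [hs]; field_simp
  -- The choice of `s` puts the ends of the segment centred at `(ρ, 0, 0)` at heights `t` and `-t`,
  -- with equal radius. The value at `-t` is bounded above, so the one at `t` is bounded below.
  have hm := hf.hconvex.le_midpoint ρ 0 0 0 (-s)
  rw [show 0 + 2 * (0 * 0 - ρ * -s) = t by linarith, show 0 - 2 * (0 * 0 - ρ * -s) = -t by linarith,
    hf.apply_eq_sqrt (ρ - 0), hf.apply_eq_sqrt (ρ + 0), hf.apply_planar hρ.le,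
    show (ρ - 0) ^ 2 + (0 - -s) ^ 2 = ρ ^ 2 + s ^ 2 by ring,
    show (ρ + 0) ^ 2 + (0 + -s) ^ 2 = ρ ^ 2 + s ^ 2 by ring] at hm
  set R := √(ρ ^ 2 + s ^ 2)
  have hρR : ρ ≤ R := Real.le_sqrt_of_sq_le (by nlinarith)
  have hRρ : R ≤ ρ + t ^ 2 / (8 * ρ ^ 3) := by
    refine Real.sqrt_le_iff.2 ⟨by positivity, ?_⟩
    have : (ρ + t ^ 2 / (8 * ρ ^ 3)) ^ 2 = ρ ^ 2 + s ^ 2 + (t ^ 2 / (8 * ρ ^ 3)) ^ 2 := by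
      rw [hs]; field_simp; ring
    rw [this]
    linarith [sq_nonneg (t ^ 2 / (8 * ρ ^ 3))]
  have hneg : f (R, 0, -t) ≤ f (1, 0, 0) * (R + t ^ 2 / (4 * ρ ^ 3)) := by
    refine (hf.apply_le (hρ.le.trans hρR) (-t)).trans (mul_le_mul_of_nonneg_left ?_ hc)
    rw [neg_sq]
    refine (Real.rpow_one_div_four_le (hρ.trans_le hρR)).trans ?_
    gcongr
  have hsum : R - t ^ 2 / (2 * ρ ^ 3) ≤ 2 * ρ - (R + t ^ 2 / (4 * ρ ^ 3)) := by
    have : t ^ 2 / (2 * ρ ^ 3) = 2 * (t ^ 2 / (8 * ρ ^ 3)) + t ^ 2 / (4 * ρ ^ 3) := by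
      field_simp; ring
    linarith
  have := mul_le_mul_of_nonneg_left hsum hc
  linarith

theorem apply_planar_le (hf : IsRadialHConvexGauge f) {r : ℝ} (hr : 0 ≤ r) (t : ℝ) :
    f (r, 0, 0) ≤ f (r, 0, t) := by
  have hlim : Tendsto (fun ρ : ℝ => f (r, 0, 0) - f (1, 0, 0) * (t ^ 2 / (2 * ρ ^ 3))) atTop
      (𝓝 (f (r, 0, 0) - f (1, 0, 0) * 0)) := by
    refine tendsto_const_nhds.sub (tendsto_const_nhds.mul (tendsto_const_nhds.div_atTop ?_))
    exact (tendsto_pow_atTop three_ne_zero).const_mul_atTop two_pos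
  rw [mul_zero, sub_zero] at hlim
  refine le_of_tendsto hlim ?_
  filter_upwards [eventually_gt_atTop r] with ρ hρ
  have hρR : ρ ≤ √(ρ ^ 2 + (t / (2 * ρ)) ^ 2) :=
    Real.le_sqrt_of_sq_le (by nlinarith [sq_nonneg (t / (2 * ρ))])
  have h1 := hf.mul_sub_le_apply (hr.trans_lt hρ) t
  have h2 := hf.apply_le_add_mul hr (hρ.trans_le hρR) t
  rw [hf.apply_planar hr]
  linarith

theorem proj_le (hf : IsRadialHConvexGauge f) (ξ : Heis) : f (proj ξ) ≤ f ξ := by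
  obtain ⟨x, y, t⟩ := ξ
  have h := hf.apply_planar_le (Real.sqrt_nonneg (x ^ 2 + y ^ 2)) t
  rwa [← hf.apply_eq_sqrt, ← hf.apply_eq_sqrt] at h

end IsRadialHConvexGauge

/-! ### From the set to its gauge -/

theorem IsRadial.mem_of_sq_eq {K : Set Heis} (hK : IsRadial K) {x y x' y' t : ℝ}
    (h : x ^ 2 + y ^ 2 = x' ^ 2 + y' ^ 2) (hm : (x, y, t) ∈ K) : (x', y', t) ∈ K :=
  (hK x y t).1 hm x' y' (by rw [h])

theorem dil_dil (a b : ℝ) (ξ : Heis) : dil a (dil b ξ) = dil (a * b) ξ := by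
  simp only [dil, Prod.mk.injEq]
  refine ⟨by ring, by ring, by ring⟩

theorem dil_mem_image_dil_iff {K : Set Heis} {a τ : ℝ} (ha : 0 < a) (ξ : Heis) :
    dil a ξ ∈ dil (a * τ) '' K ↔ ξ ∈ dil τ '' K := by
  constructor
  · rintro ⟨η, hη, h⟩
    refine ⟨η, hη, ?_⟩
    have := congrArg (dil a⁻¹) h
    rw [dil_dil, dil_dil, inv_mul_cancel_left₀ ha.ne', inv_mul_cancel₀ ha.ne'] at this
    simpa [dil] using this
  · rintro ⟨η, hη, rfl⟩
    exact ⟨η, hη, (dil_dil _ _ _).symm⟩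

theorem eq_of_forall_le_iff_of_nonneg {a b : ℝ} (ha : 0 ≤ a) (hb : 0 ≤ b)
    (h : ∀ τ, 0 ≤ τ → (a ≤ τ ↔ b ≤ τ)) : a = b :=
  le_antisymm ((h b hb).2 le_rfl) ((h a ha).1 le_rfl)

/-- The H-convex function whose sublevel sets are the dilates of a radial set. -/
theorem isRadialHConvexGauge_of_lev {K : Set Heis} (hrad : IsRadial K) {f : Heis → ℝ}
    (hconv : HConvex f) (hlev : ∀ τ, 0 ≤ τ → ∀ ξ, f ξ ≤ τ ↔ ξ ∈ dil τ '' K) :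
    IsRadialHConvexGauge f := by
  have hpos : ∀ ξ : Heis, ξ ≠ e → 0 < f ξ := by
    intro ξ hξ
    by_contra! h
    obtain ⟨η, -, rfl⟩ := (hlev 0 le_rfl ξ).1 h
    exact hξ (by simp [dil, e])
  have hhom_le : ∀ (a : ℝ) (ξ : Heis), 0 < a → ∀ τ, 0 ≤ τ → (f (dil a ξ) ≤ τ ↔ a * f ξ ≤ τ) := by
    intro a ξ ha τ hτ
    rw [← le_div_iff₀' ha, hlev τ hτ, hlev (τ / a) (by positivity),
      ← dil_mem_image_dil_iff ha ξ, mul_div_cancel₀ _ ha.ne']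
  have hv : (0 : ℝ) < f (1, 0, 0) := hpos _ (by simp [e])
  have hhalf : f (1 / 2, 0, 0) = 1 / 2 * f (1, 0, 0) := by
    refine eq_of_forall_le_iff_of_nonneg (hpos _ (by simp [e])).le (by positivity) fun τ hτ => ?_
    rw [← hhom_le (1 / 2) _ (by norm_num) τ hτ]
    simp [dil]
  -- The levels `τ ≥ 0` only give upper bounds at the origin; the sign comes from convexity on the
  -- segment from `e` to `(1, 0, 0)`, whose midpoint value is already half the end value.
  have he : 0 ≤ f e := by
    have h := hconv e (1, 0) (1 / 2) (by norm_num) (by norm_num)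
    have e1 : op e (hexp ((1 / 2 : ℝ) • (1, 0))) = (1 / 2, 0, 0) := by simp [op, e, hexp]
    have e2 : op e (hexp (1, 0)) = (1, 0, 0) := by simp [op, e, hexp]
    rw [e1, e2, hhalf] at h
    linarith
  have hnn : ∀ ξ, 0 ≤ f ξ := by
    intro ξ
    rcases eq_or_ne ξ e with rfl | h
    · exact he
    · exact (hpos ξ h).le
  refine ⟨hconv, fun x y x' y' t h => ?_, fun a ξ ha => ?_, hpos⟩
  · have key : ∀ {x y x' y' : ℝ}, x ^ 2 + y ^ 2 = x' ^ 2 + y' ^ 2 → f (x', y', t) ≤ f (x, y, t) := by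
      intro x y x' y' h
      obtain ⟨τ, hτe⟩ : ∃ τ, f (x, y, t) = τ := ⟨_, rfl⟩
      have hτ : 0 ≤ τ := hτe ▸ hnn _
      rw [hτe]
      refine (hlev τ hτ _).2 ?_
      obtain ⟨⟨a, b, c⟩, hη, hd⟩ := (hlev τ hτ (x, y, t)).1 hτe.le
      simp only [dil, Prod.mk.injEq] at hd
      obtain ⟨hx0, hy0, hc⟩ := hd
      rw [← hx0, ← hy0] at h
      -- The dilation with `τ = 0` collapses everything to the origin and cannot be undone.
      rcases hτ.eq_or_lt with h0 | h0
      · rw [← h0] at h ⊢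
        have hx : x' = 0 := by nlinarith [sq_nonneg x', sq_nonneg y']
        have hy : y' = 0 := by nlinarith [sq_nonneg x', sq_nonneg y']
        exact ⟨(a, b, c), hη, by simp [dil, hx, hy, ← hc, ← h0]⟩
      · refine ⟨(x' / τ, y' / τ, c), hrad.mem_of_sq_eq ?_ hη, ?_⟩
        · rw [div_pow, div_pow, ← add_div, ← h]
          field_simp
        · simp only [dil, mul_div_cancel₀ _ h0.ne', hc]
    exact le_antisymm (key h.symm) (key h)
  · exact eq_of_forall_le_iff_of_nonneg (hnn _) (mul_nonneg ha.le (hnn _)) (hhom_le a ξ ha)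

end Heis

theorem theorem1p2 (K : Set Heis) (hK : IsCompact K) (hrad : Heis.IsRadial K)
    (hgen : Heis.GeneratesHConvexFamily K) :
    (∀ x₀ y₀ : ℝ, ((x₀, y₀, 0) : Heis) ∈ frontier K →
      Heis.gaugeBall Heis.e (Heis.gauge (x₀, y₀, 0)) ⊆ K) ∧
    Heis.proj '' K ⊆ K := by
  obtain ⟨-, f, hconv, hfam⟩ := hgen
  have hlev : ∀ τ, 0 ≤ τ → ∀ ξ, f ξ ≤ τ ↔ ξ ∈ Heis.dil τ '' K := fun τ hτ ξ =>
    Set.ext_iff.1 (hfam τ hτ) ξ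
  have hf := Heis.isRadialHConvexGauge_of_lev hrad hconv hlev
  have hmem : ∀ ξ, f ξ ≤ 1 ↔ ξ ∈ K := fun ξ => by
    rw [hlev 1 zero_le_one, show Heis.dil 1 = id by ext <;> simp [Heis.dil], Set.image_id]
  refine ⟨fun x₀ y₀ h₀ => ?_, ?_⟩
  · rintro _ ⟨ξ, hξ, rfl⟩
    have hop : Heis.op Heis.e ξ = ξ := by simp [Heis.op, Heis.e]
    rw [hop, ← hmem]
    have hg : Heis.gauge (x₀, y₀, 0) = √(x₀ ^ 2 + y₀ ^ 2) := by
      have : (0 : ℝ) ≤ x₀ ^ 2 + y₀ ^ 2 := by positivity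
      simp only [Heis.gauge]
      rw [zero_pow two_ne_zero, add_zero, Real.sqrt_eq_rpow, ← Real.rpow_natCast,
        ← Real.rpow_mul this]
      norm_num
    calc f ξ ≤ f (1, 0, 0) * Heis.gauge ξ := hf.le_gauge ξ
      _ ≤ f (1, 0, 0) * √(x₀ ^ 2 + y₀ ^ 2) :=
        mul_le_mul_of_nonneg_left (hg ▸ hξ) (hf.nonneg _)
      _ = f (x₀, y₀, 0) := by
        rw [hf.apply_eq_sqrt x₀ y₀, hf.apply_planar (Real.sqrt_nonneg _), mul_comm]
      _ ≤ 1 := (hmem _).2 (hK.isClosed.frontier_subset h₀)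
  · rintro _ ⟨ξ, hξ, rfl⟩
    exact (hmem _).1 ((hf.proj_le ξ).trans ((hmem ξ).2 hξ))
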